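/- **Setting.** Write $\|\cdot\|$ for the Euclidean norm, $\mathsf B^d(R)=\{x\in\mathbb R^d:\|x\|\le R\}$, $\gamma_d$ for the standard Gaussian measure on $\mathbb R^d$, and $Q_tf(x)=\int_{\mathbb R^d} f(x+\sqrt t\,z)\,\gamma_d(dz)$. A *neural net* with $n$ inputs and $p$ outputs consists of one or more nonempty layers of nodes. Each node receives the inputs (first layer) or the outcomes of all nodes of the preceding layer, $u_1,\dots,u_k$, and computes $(u_1,\dots,u_k)\mapsto\phi(w_1u_1+\dots+w_ku_k+\beta)$ with its own real weights $w_j,\beta$ and its own activation function $\phi$. The $p$ outputs are linear combinations of the outcomes of the nodes of the last layer. The *depth* is the number of layers of nodes plus one, and the *size* is the total number of nodes. **Assumption on $\sigma$.** Let $\sigma:\mathbb R\to\mathbb R$ be differentiable and universal: there is a constant $c_\sigma>0$ such that, for all $L\ge0$ and $R,\delta>0$ and every $L$-Lipschitz $h:\mathbb R\to\mathbb R$ that is constant outside $[-R,R]$, there are $m\le c_\sigma RL/\delta$ and real $a,\alpha_i,\beta_i,\gamma_i$ ($1\le i\le m$) with $\sup_{x\in\mathbb R}\bigl|a+\sum_{i=1}^m\alpha_i\sigma(\beta_ix+\gamma_i)-h(x)\bigr|\le\delta$.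 **Assumptions on $f$.** Let $\mu$ be a probability measure on $\mathbb R^d$ with density $f=d\mu/d\gamma_d$, where $f$ is differentiable, $f$ and $\nabla f$ are $L$-Lipschitz, and $f\ge c$ everywhere for some $c\in(0,1]$. Let $P$ be a polynomial such that for all $R,\varepsilon>0$ there is a neural net $\hat f:\mathbb R^d\to\mathbb R$, all of whose activation functions are $\sigma$, of depth and size at most $P(1/\varepsilon,d,L,R)$, with $$\sup_{x\in\mathsf B^d(R)}|f(x)-\hat f(x)|\le\varepsilon\quad\text{and}\quad\sup_{x\in\mathsf B^d(R)}\|\nabla f(x)-\nabla\hat f(x)\|\le\varepsilon .$$ **Theorem.** For every $\sigma$ and $P$ as above there is a polynomial $S$, depending only on $\sigma$ and $P$, such that the following holds for all $d$, $\mu$, $f$, $L$, $c$ as above and all $0<\varepsilon<4L/c$ and $R>0$. There is a neural net $\hat v=(\hat v_1,\dots,\hat v_d):\mathbb R^d\times[0,1]\to\mathbb R^d$ (with $d+1$ real inputs) of size at most $S(1/\varepsilon,d,L,R,c,1/c)$, with the activation function of each node in $\{\sigma,\sigma',\mathrm{ReLU}\}$, where $\mathrm{ReLU}(u)=\max(u,0)$,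 such that $$\sup_{x\in\mathsf B^d(R)}\ \sup_{t\in[0,1]}\bigl\|\hat v(x,\sqrt t)-\nabla\log Q_tf(x)\bigr\|\le\varepsilon \qquad\text{and}\qquad \max_{1\le i\le d}\ \sup_{x\in\mathbb R^d}\ \sup_{t\in[0,1]}|\hat v_i(x,\sqrt t)|\le\frac{2L}{c}.$$ -/

import Mathlib

open MeasureTheory ProbabilityTheory
open scoped Matrix Gradient

noncomputable section

/-- One layer of a feedforward net, with `k` inputs and `m ≥ 1` nodes. Node `i` receives
`u₁, …, uₖ` and outputs `act i (∑ j, weight i j * u j + bias i)`. Every node has its own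
activation function. -/
structure NeuralLayer (k m : ℕ) where
  width_pos : 0 < m
  weight : Matrix (Fin m) (Fin k) ℝ
  bias : Fin m → ℝ
  act : Fin m → ℝ → ℝ

namespace NeuralLayer

/-- The vector of outputs of the nodes of a layer. -/
def eval {k m : ℕ} (A : NeuralLayer k m) (u : Fin k → ℝ) : Fin m → ℝ :=
  fun i => A.act i ((A.weight *ᵥ u) i + A.bias i)

end NeuralLayer

/-- A nonempty stack of layers on `n` inputs; the second index is the number of nodes in the last
layer. The outcomes of the nodes of a layer are communicated to all the nodes of the next one. -/
inductive NeuralStack (n : ℕ) : ℕ → Type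
  | first {m : ℕ} (A : NeuralLayer n m) : NeuralStack n m
  | next {k m : ℕ} (S : NeuralStack n k) (A : NeuralLayer k m) : NeuralStack n m

namespace NeuralStack

/-- The outputs of the nodes of the last layer of the stack. -/
def eval {n : ℕ} : {m : ℕ} → NeuralStack n m → (Fin n → ℝ) → Fin m → ℝ
  | _, first A, x => A.eval x
  | _, next S A, x => A.eval (S.eval x)

/-- The number of layers of the stack. -/
def length {n : ℕ} : {m : ℕ} → NeuralStack n m → ℕ
  | _, first _ => 1
  | _, next S _ => S.length + 1

/-- The total number of nodes of the stack. -/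
def size {n : ℕ} : {m : ℕ} → NeuralStack n m → ℕ
  | m, first _ => m
  | m, next S _ => S.size + m

/-- Every node of the stack has an activation function in `Φ`. -/
def ActivationsIn {n : ℕ} (Φ : Set (ℝ → ℝ)) : {m : ℕ} → NeuralStack n m → Prop
  | _, first A => ∀ i, A.act i ∈ Φ
  | _, next S A => S.ActivationsIn Φ ∧ ∀ i, A.act i ∈ Φ

end NeuralStack

/-- A feedforward neural net with `n` inputs and `p` outputs: a stack of layers of nodes, followed
by linear combinations of the outcomes of the nodes of the last layer. -/
structure NeuralNet (n p : ℕ) where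
  width : ℕ
  stack : NeuralStack n width
  out : Matrix (Fin p) (Fin width) ℝ

namespace NeuralNet

/-- The function computed by a net. -/
def eval {n p : ℕ} (N : NeuralNet n p) (x : Fin n → ℝ) : Fin p → ℝ :=
  N.out *ᵥ N.stack.eval x

/-- The number of layers, the output layer included. A single layer of nodes followed by a linear
combination, `x ↦ ∑ i, α i * σ (w i ⬝ᵥ x + β i)`, has depth `2`. -/
def depth {n p : ℕ} (N : NeuralNet n p) : ℕ := N.stack.length + 1

/-- The number of nodes. -/
def size {n p : ℕ} (N : NeuralNet n p) : ℕ := N.stack.size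

/-- Every node of the net has an activation function in `Φ`. -/
def ActivationsIn {n p : ℕ} (Φ : Set (ℝ → ℝ)) (N : NeuralNet n p) : Prop :=
  N.stack.ActivationsIn Φ

end NeuralNet

/-- The rectified linear unit. -/
def reluActivation (u : ℝ) : ℝ := max u 0

/-- A differentiable activation function `σ` is universal if there is a constant `cσ > 0` such that
every `L`-Lipschitz function on the line that is constant outside `[-R, R]` can be approximated
uniformly to accuracy `δ` by some `x ↦ a + ∑ i < m, α i * σ (β i * x + γ i)` with
`m ≤ cσ * R * L / δ`. -/
structure IsUniversalActivation (σ : ℝ → ℝ) : Prop where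
  differentiable : Differentiable ℝ σ
  approx : ∃ cσ : ℝ, 0 < cσ ∧ ∀ L R δ : ℝ, 0 ≤ L → 0 < R → 0 < δ → ∀ h : ℝ → ℝ,
    (∀ x y, |h x - h y| ≤ L * |x - y|) → (∃ k, ∀ x, x ∉ Set.Icc (-R) R → h x = k) →
    ∃ (m : ℕ) (a : ℝ) (α β γ : Fin m → ℝ), (m : ℝ) ≤ cσ * (R * L / δ) ∧
      ∀ x, |(a + ∑ i, α i * σ (β i * x + γ i)) - h x| ≤ δ

/-- `f` is differentiable, `f` and `∇ f` are `L`-Lipschitz, and `f ≥ c` with `c ∈ (0, 1]`. -/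
structure IsRegularDensity {d : ℕ} (f : EuclideanSpace ℝ (Fin d) → ℝ) (L c : ℝ) : Prop where
  differentiable : Differentiable ℝ f
  lipschitz : ∀ x y, |f x - f y| ≤ L * ‖x - y‖
  lipschitz_gradient : ∀ x y, ‖∇ f x - ∇ f y‖ ≤ L * ‖x - y‖
  pos : 0 < c
  le_one : c ≤ 1
  lower_bound : ∀ x, c ≤ f x

/-- For all `R, ε > 0`, the function `f` and its gradient can be approximated within `ε` on the
ball of radius `R` by a neural net with activation function `σ` and its gradient, where depth and
size of the net are at most `P(1/ε, d, L, R)`. -/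
def NeuralApproximable {d : ℕ} (σ : ℝ → ℝ) (P : MvPolynomial (Fin 4) ℝ) (L : ℝ)
    (f : EuclideanSpace ℝ (Fin d) → ℝ) : Prop :=
  ∀ R ε : ℝ, 0 < R → 0 < ε → ∃ N : NeuralNet d 1, N.ActivationsIn {σ} ∧
    (N.depth : ℝ) ≤ MvPolynomial.eval ![1 / ε, (d : ℝ), L, R] P ∧
    (N.size : ℝ) ≤ MvPolynomial.eval ![1 / ε, (d : ℝ), L, R] P ∧
    ∀ x ∈ Metric.closedBall (0 : EuclideanSpace ℝ (Fin d)) R,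
      |f x - N.eval x.ofLp 0| ≤ ε ∧
      ‖∇ f x - ∇ (fun y : EuclideanSpace ℝ (Fin d) => N.eval y.ofLp 0) x‖ ≤ ε

/-- The Euclidean heat semigroup `Q_t f(x) = 𝔼 f(x + √t Z)`, with `Z` standard Gaussian. -/
def heatSemigroup {d : ℕ} (t : ℝ) (f : EuclideanSpace ℝ (Fin d) → ℝ)
    (x : EuclideanSpace ℝ (Fin d)) : ℝ :=
  ∫ z, f (x + √t • z) ∂(stdGaussian (EuclideanSpace ℝ (Fin d)))

/-- The value at `(x, s) ∈ ℝᵈ × ℝ` of a net with `d + 1` inputs and `d` outputs, as a vector of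
the Euclidean space. -/
def NeuralNet.drift {d : ℕ} (N : NeuralNet (d + 1) d) (x : EuclideanSpace ℝ (Fin d)) (s : ℝ) :
    EuclideanSpace ℝ (Fin d) :=
  WithLp.toLp 2 (N.eval (Fin.snoc (α := fun _ => ℝ) x.ofLp s))

end

/-! Write `s = √t` and let `q_s(x)` be the Gaussian mean of `f (x + s • z)`. The net imitates a
difference quotient of `log q_s`, in four stages.

The mean is replaced by an average over finitely many fixed vectors. Truncating the Gaussian at
radius `ρ` makes the increments of `f` bounded, so Hoeffding's inequality and a union bound over a
grid of pairs `(x, s)` produce one sample that is good on the whole grid; the Lipschitz property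
extends this to the ball (`exists_sample_heat`). The grid is exponentially large in `d`, but only
its logarithm enters the sample size. In the average, `f` is replaced by copies of its approximating
net.

The logarithm is Lipschitz on `[c, ∞)` and `q_s` is bounded on the ball, so one layer of `σ` nodes
approximates `log q_s` (`IsUniversalActivation.exists_log_approx`).

The gradient of `log q_s` is Lipschitz with constant `L / c + (L / c) ^ 2`, so the difference
quotient with step `h` has bias `O(h)`, while an error `κ` in the logarithm costs `2 * κ / h`
(`IsRegularDensity.abs_slope_sub_gradient_log_heat_le`).

Finally each coordinate is clipped to `[-L / c, L / c]` by ReLU nodes. The true partial derivatives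
lie in this interval, so clipping gives the global bound without increasing the error.

`NeuralNet.exists_drift_eq_clip` builds the net, `IsRegularDensity.exists_drift_approx` collects the
errors, and all parameters are powers of one number `X` that dominates the data. -/

/-! ### Composition of layers and parallel copies of nets -/

theorem NeuralStack.ActivationsIn.mono {Φ Ψ : Set (ℝ → ℝ)} (h : Φ ⊆ Ψ) {n m : ℕ}
    {S : NeuralStack n m} (hS : S.ActivationsIn Φ) : S.ActivationsIn Ψ := by
  induction S with
  | first A => exact fun i => h (hS i)
  | next S A ih => exact ⟨ih hS.1, fun i => h (hS.2 i)⟩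

/-- The function `F`, with outputs indexed by `ι`, is computed by the nodes of the last layer of a
stack with `s` nodes and activation functions in `Φ`. -/
def NeuralRealizable (Φ : Set (ℝ → ℝ)) {n : ℕ} {ι : Type*} (F : (Fin n → ℝ) → ι → ℝ) (s : ℕ) :
    Prop :=
  ∃ (m : ℕ) (e : ι ≃ Fin m) (S : NeuralStack n m), S.ActivationsIn Φ ∧ S.size = s ∧
    ∀ x i, S.eval x (e i) = F x i

namespace NeuralRealizable

variable {Φ : Set (ℝ → ℝ)} {n : ℕ} {ι κ : Type*} [Fintype ι] [Fintype κ]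

theorem first [Nonempty κ] (w : κ → Fin n → ℝ) (b : κ → ℝ) (φ : κ → ℝ → ℝ) (hφ : ∀ k, φ k ∈ Φ) :
    NeuralRealizable Φ (fun (x : Fin n → ℝ) k => φ k (∑ j, w k j * x j + b k))
      (Fintype.card κ) := by
  let e := Fintype.equivFin κ
  refine ⟨_, e, .first ⟨Fintype.card_pos, Matrix.of fun i j => w (e.symm i) j,
    fun i => b (e.symm i), fun i => φ (e.symm i)⟩, fun i => hφ _, rfl, fun x i => ?_⟩
  simp [NeuralStack.eval, NeuralLayer.eval, Matrix.mulVec, dotProduct]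

theorem next {F : (Fin n → ℝ) → ι → ℝ} {s : ℕ} (hF : NeuralRealizable Φ F s) [Nonempty κ]
    (w : κ → ι → ℝ) (b : κ → ℝ) (φ : κ → ℝ → ℝ) (hφ : ∀ k, φ k ∈ Φ) :
    NeuralRealizable Φ (fun x k => φ k (∑ i, w k i * F x i + b k)) (s + Fintype.card κ) := by
  obtain ⟨m, e', S, hS, rfl, hF⟩ := hF
  let e := Fintype.equivFin κ
  refine ⟨_, e, .next S ⟨Fintype.card_pos, Matrix.of fun i j => w (e.symm i) (e'.symm j),
    fun i => b (e.symm i), fun i => φ (e.symm i)⟩, ⟨hS, fun i => hφ _⟩, rfl, fun x i => ?_⟩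
  simp only [NeuralStack.eval, NeuralLayer.eval, Matrix.mulVec, dotProduct, Matrix.of_apply,
    Equiv.symm_apply_apply, ← hF]
  rw [← e'.sum_comp]
  simp

/-- An affine change of input is absorbed into the weights and biases of the first layer; every
later layer becomes block diagonal, one block per copy. -/
theorem parallel {n' m : ℕ} (S : NeuralStack n m) (hS : S.ActivationsIn Φ) [Nonempty κ]
    (w : κ → Fin n → Fin n' → ℝ) (b : κ → Fin n → ℝ) :
    NeuralRealizable Φ (fun (x : Fin n' → ℝ) (p : κ × Fin m) =>
      S.eval (fun i => ∑ j, w p.1 i j * x j + b p.1 i) p.2) (Fintype.card κ * S.size) := by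
  classical
  induction S with
  | @first m A =>
    have : Nonempty (Fin m) := ⟨⟨0, A.width_pos⟩⟩
    have h := NeuralRealizable.first (Φ := Φ) (fun (p : κ × Fin m) j => ∑ i, A.weight p.2 i * w p.1 i j)
      (fun p => ∑ i, A.weight p.2 i * b p.1 i + A.bias p.2) (fun p => A.act p.2) (fun p => hS p.2)
    convert h using 3 with x p
    · simp only [NeuralStack.eval, NeuralLayer.eval, Matrix.mulVec, dotProduct, mul_add,
        Finset.sum_add_distrib, Finset.mul_sum, Finset.sum_mul, add_assoc]
      rw [Finset.sum_comm]
      simp only [mul_assoc]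
    · simp [NeuralStack.size]
  | @next k m S A ih =>
    have : Nonempty (Fin m) := ⟨⟨0, A.width_pos⟩⟩
    have h := (ih hS.1).next (fun (p : κ × Fin m) (q : κ × Fin k) =>
      if p.1 = q.1 then A.weight p.2 q.2 else 0) (fun p => A.bias p.2) (fun p => A.act p.2)
      (fun p => hS.2 p.2)
    convert h using 3 with x p
    · simp [NeuralStack.eval, NeuralLayer.eval, Matrix.mulVec, dotProduct, Fintype.sum_prod_type]
    · simp [NeuralStack.size, mul_add]

theorem exists_net {F : (Fin n → ℝ) → ι → ℝ} {s : ℕ} (hF : NeuralRealizable Φ F s) {p : ℕ}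
    (w : Fin p → ι → ℝ) :
    ∃ N : NeuralNet n p, N.ActivationsIn Φ ∧ N.size = s ∧
      ∀ x k, N.eval x k = ∑ i, w k i * F x i := by
  obtain ⟨m, e, S, hS, hs, hF⟩ := hF
  refine ⟨⟨m, S, Matrix.of fun k i => w k (e.symm i)⟩, hS, hs, fun x k => ?_⟩
  simp only [NeuralNet.eval, Matrix.mulVec, dotProduct, Matrix.of_apply, ← hF]
  rw [← e.sum_comp]
  simp

end NeuralRealizable

/-! ### Simultaneous concentration of empirical means -/

/-- The empirical means of finitely many bounded functions are simultaneously close to their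
expectations for some sample, if the sample size is large enough. -/
theorem exists_sample_forall_abs_sub_integral_le {Ω K : Type*} [MeasurableSpace Ω] (ν : Measure Ω)
    [IsProbabilityMeasure ν] [Fintype K] {g : K → Ω → ℝ} (hg : ∀ k, Measurable (g k))
    {B η : ℝ} (hB : 0 < B) (hη : 0 < η) (hgB : ∀ k ω, |g k ω| ≤ B) {N : ℕ} (hN : 0 < N)
    (h : 2 * (Fintype.card K : ℝ) * Real.exp (-(N * η ^ 2 / (2 * B ^ 2))) < 1) :
    ∃ z : Fin N → Ω, ∀ k, |(N : ℝ)⁻¹ * ∑ j, g k (z j) - ∫ ω, g k ω ∂ν| ≤ η := by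
  have hN' : (0 : ℝ) < N := Nat.cast_pos.2 hN
  let P : Measure (Fin N → Ω) := Measure.pi fun _ => ν
  -- Hoeffding's lemma gives the square of half the length of `[-B, B]` as sub-Gaussian parameter.
  have hB2 : (‖B - -B‖₊ / 2) ^ 2 = (Real.toNNReal B) ^ 2 := by
    congr 1
    ext
    simp only [NNReal.coe_div, coe_nnnorm, Real.norm_eq_abs, Real.coe_toNNReal _ hB.le,
      NNReal.coe_ofNat]
    rw [abs_of_pos (by linarith)]; ring
  have key (Y : Ω → ℝ) (hY : Measurable Y) (hYB : ∀ ω, |Y ω| ≤ B) :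
      P.real {z | N * η ≤ ∑ j, (Y (z j) - ∫ ω, Y ω ∂ν)} ≤ Real.exp (-(N * η ^ 2 / (2 * B ^ 2))) := by
    have hsub : HasSubgaussianMGF (fun ω => Y ω - ∫ ω, Y ω ∂ν) ((Real.toNNReal B) ^ 2) ν := by
      have := hasSubgaussianMGF_of_mem_Icc (μ := ν) (X := Y) (a := -B) (b := B) hY.aemeasurable
        (ae_of_all _ fun ω => abs_le.1 (hYB ω))
      rwa [hB2] at this
    have hi : iIndepFun (fun (j : Fin N) (z : Fin N → Ω) => Y (z j) - ∫ ω, Y ω ∂ν) P :=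
      iIndepFun_pi (X := fun _ ω => Y ω - ∫ ω, Y ω ∂ν)
        (fun _ => (hY.sub_const _).aemeasurable)
    have hs (j : Fin N) : HasSubgaussianMGF (fun z : Fin N → Ω => Y (z j) - ∫ ω, Y ω ∂ν)
        ((Real.toNNReal B) ^ 2) P := by
      have hm : P.map (fun z => z j) = ν := (measurePreserving_eval (fun _ : Fin N => ν) j).map_eq
      refine HasSubgaussianMGF.of_map (Y := fun z : Fin N → Ω => z j)
        (X := fun ω => Y ω - ∫ ω, Y ω ∂ν) (measurable_pi_apply j).aemeasurable ?_
      rwa [hm]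
    have := HasSubgaussianMGF.measure_sum_ge_le_of_iIndepFun hi (s := Finset.univ)
      (fun j _ => hs j) (ε := N * η) (by positivity)
    refine this.trans_eq ?_
    congr 1
    simp only [Finset.sum_const, Finset.card_univ, Fintype.card_fin, nsmul_eq_mul]
    push_cast
    rw [Real.coe_toNNReal _ hB.le]
    field_simp
  let A (k : K) : Set (Fin N → Ω) := {z | N * η ≤ ∑ j, (g k (z j) - ∫ ω, g k ω ∂ν)}
  let A' (k : K) : Set (Fin N → Ω) := {z | N * η ≤ ∑ j, ((-g k (z j)) - ∫ ω, -g k ω ∂ν)}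
  have hlt : P.real (⋃ k, A k ∪ A' k) < 1 := by
    calc P.real (⋃ k, A k ∪ A' k) ≤ ∑ k, P.real (A k ∪ A' k) := measureReal_iUnion_fintype_le _
      _ ≤ ∑ k : K, 2 * Real.exp (-(N * η ^ 2 / (2 * B ^ 2))) := by
        refine Finset.sum_le_sum fun k _ => (measureReal_union_le _ _).trans ?_
        have h1 := key (g k) (hg k) (hgB k)
        have h2 := key (fun ω => -g k ω) (hg k).neg (fun ω => by simpa using hgB k ω)
        linarith
      _ < 1 := by simpa [mul_comm, mul_left_comm, mul_assoc] using h
  -- The upper and lower tail events together have probability below one, so some sample avoids them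
  -- all.
  have hne : (⋃ k, A k ∪ A' k) ≠ Set.univ := by
    intro hu
    rw [hu] at hlt
    simp at hlt
  obtain ⟨z, hz⟩ := (Set.ne_univ_iff_exists_notMem _).1 hne
  refine ⟨z, fun k => ?_⟩
  simp only [Set.mem_iUnion, Set.mem_union, not_exists, not_or, A, A', Set.mem_ofPred_eq, not_le,
    integral_neg, Finset.sum_sub_distrib, Finset.sum_neg_distrib, Finset.sum_const,
    Finset.card_univ, Fintype.card_fin, nsmul_eq_mul] at hz
  obtain ⟨h1, h2⟩ := hz k
  have : (N : ℝ)⁻¹ * ∑ j, g k (z j) - ∫ ω, g k ω ∂ν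
      = (N : ℝ)⁻¹ * (∑ j, g k (z j) - N * ∫ ω, g k ω ∂ν) := by field_simp
  rw [this, abs_mul, abs_of_pos (inv_pos.2 hN'), inv_mul_le_iff₀ hN', abs_le]
  constructor <;> linarith

/-! ### Moments and truncation of the standard Gaussian -/

section StdGaussian

variable {d : ℕ}

local notation "V" => EuclideanSpace ℝ (Fin d)

theorem memLp_norm_stdGaussian : MemLp (fun z : V => ‖z‖) 2 (stdGaussian V) :=
  (IsGaussian.memLp_two_id (μ := stdGaussian V)).norm

theorem integrable_norm_stdGaussian : Integrable (fun z : V => ‖z‖) (stdGaussian V) :=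
  (IsGaussian.integrable_id (μ := stdGaussian V)).norm

theorem integrable_norm_sq_stdGaussian : Integrable (fun z : V => ‖z‖ ^ 2) (stdGaussian V) :=
  memLp_norm_stdGaussian.integrable_sq

theorem integral_eval_sq_stdGaussian (i : Fin d) : ∫ z : V, z i ^ 2 ∂(stdGaussian V) = 1 := by
  have h := measurePreserving_eval_multivariateGaussian (μ := (0 : V))
    (S := (1 : Matrix (Fin d) (Fin d) ℝ)) Matrix.PosSemidef.one (i := i)
  have hv := variance_eval_multivariateGaussian (μ := (0 : V))
    (S := (1 : Matrix (Fin d) (Fin d) ℝ)) Matrix.PosSemidef.one i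
  have h0 : ∫ z : V, z i ∂(multivariateGaussian (0 : V) 1) = 0 := by
    rw [← integral_map (φ := fun x : V => x i) (f := fun x : ℝ => x) h.measurable.aemeasurable
      (by fun_prop), h.map_eq]
    simp
  rw [variance_of_integral_eq_zero h.measurable.aemeasurable h0] at hv
  simpa using hv

theorem integral_norm_sq_stdGaussian : ∫ z : V, ‖z‖ ^ 2 ∂(stdGaussian V) = d := by
  have (i : Fin d) : Integrable (fun z : V => z i ^ 2) (stdGaussian V) := by
    refine integrable_norm_sq_stdGaussian.mono' (by fun_prop) (ae_of_all _ fun z => ?_)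
    rw [norm_pow]
    gcongr
    exact PiLp.norm_apply_le z i
  simp_rw [EuclideanSpace.real_norm_sq_eq]
  rw [integral_finsetSum _ fun i _ => this i]
  simp [integral_eval_sq_stdGaussian]

theorem integral_norm_stdGaussian_le : ∫ z : V, ‖z‖ ∂(stdGaussian V) ≤ d + 1 := by
  have : ∫ z : V, ‖z‖ ∂(stdGaussian V) ≤ ∫ z : V, (‖z‖ ^ 2 + 1) ∂(stdGaussian V) :=
    integral_mono integrable_norm_stdGaussian
      (integrable_norm_sq_stdGaussian.add (integrable_const _))
      fun z => by nlinarith [sq_nonneg (‖z‖ - 1), norm_nonneg z]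
  refine this.trans_eq ?_
  rw [integral_add integrable_norm_sq_stdGaussian (integrable_const _),
    integral_norm_sq_stdGaussian]
  simp

end StdGaussian

/-- The vector `z` if `‖z‖ ≤ ρ`, and zero otherwise. -/
noncomputable def normTruncation {E : Type*} [NormedAddCommGroup E] (ρ : ℝ) (z : E) : E :=
  (Metric.closedBall (0 : E) ρ).indicator id z

section Truncation

variable {E : Type*} [NormedAddCommGroup E]

theorem measurable_normTruncation [MeasurableSpace E] [BorelSpace E] (ρ : ℝ) :
    Measurable (normTruncation (E := E) ρ) :=
  measurable_id.indicator Metric.isClosed_closedBall.measurableSet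

theorem norm_normTruncation_le {ρ : ℝ} (hρ : 0 ≤ ρ) (z : E) : ‖normTruncation ρ z‖ ≤ ρ := by
  unfold normTruncation
  by_cases h : z ∈ Metric.closedBall (0 : E) ρ
  · rw [Set.indicator_of_mem h]
    simpa using h
  · rwa [Set.indicator_of_notMem h, norm_zero]

/-- Outside the ball `1 ≤ ‖z‖ / ρ`. This turns the second moment `d` into a truncation error of
order `d / ρ`. -/
theorem norm_sub_normTruncation_le {ρ : ℝ} (hρ : 0 < ρ) (z : E) :
    ‖z - normTruncation ρ z‖ ≤ ‖z‖ ^ 2 / ρ := by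
  unfold normTruncation
  by_cases h : z ∈ Metric.closedBall (0 : E) ρ
  · rw [Set.indicator_of_mem h]
    simp only [id_eq, sub_self, norm_zero]
    positivity
  · rw [Set.indicator_of_notMem h, sub_zero, le_div_iff₀ hρ, sq]
    simp only [mem_closedBall_zero_iff, not_le] at h
    gcongr

end Truncation

/-! ### Lipschitz estimates for the heat semigroup -/

section Lipschitz

variable {d : ℕ} {f : EuclideanSpace ℝ (Fin d) → ℝ} {L : ℝ}

local notation "V" => EuclideanSpace ℝ (Fin d)

theorem continuous_of_abs_sub_le {E : Type*} [NormedAddCommGroup E] {f : E → ℝ} {L : ℝ}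
    (hf : ∀ x y, |f x - f y| ≤ L * ‖x - y‖) : Continuous f :=
  (LipschitzWith.of_dist_le_mul (K := L.toNNReal) fun x y => by
    rw [Real.dist_eq, dist_eq_norm]
    exact (hf x y).trans (mul_le_mul_of_nonneg_right (Real.le_coe_toNNReal L)
      (norm_nonneg _))).continuous

theorem integrable_comp_of_abs_sub_le (hf : ∀ x y, |f x - f y| ≤ L * ‖x - y‖) (x : V) (s : ℝ)
    {w : V → V} (hw : Measurable w) (hwi : Integrable (fun z => ‖w z‖) (stdGaussian V)) :
    Integrable (fun z => f (x + s • w z)) (stdGaussian V) := by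
  have hc := continuous_of_abs_sub_le hf
  have hb : Integrable (fun z => |f x| + L * (|s| * ‖w z‖)) (stdGaussian V) :=
    (integrable_const _).add ((hwi.const_mul _).const_mul _)
  refine hb.mono' (hc.measurable.comp (by fun_prop)).aestronglyMeasurable (ae_of_all _ fun z => ?_)
  have := hf (x + s • w z) x
  rw [add_sub_cancel_left, norm_smul, Real.norm_eq_abs] at this
  rw [Real.norm_eq_abs]
  linarith [abs_sub_abs_le_abs_sub (f (x + s • w z)) (f x)]

theorem integrable_norm_normTruncation {ρ : ℝ} (hρ : 0 ≤ ρ) :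
    Integrable (fun z : V => ‖normTruncation ρ z‖) (stdGaussian V) :=
  (integrable_const ρ).mono' (measurable_normTruncation ρ).norm.aestronglyMeasurable
    (ae_of_all _ fun z => by simpa using norm_normTruncation_le hρ z)

theorem integrable_heat (hf : ∀ x y, |f x - f y| ≤ L * ‖x - y‖) (x : V) (s : ℝ) :
    Integrable (fun z => f (x + s • z)) (stdGaussian V) :=
  integrable_comp_of_abs_sub_le hf x s (w := fun z => z) measurable_id integrable_norm_stdGaussian

theorem integrable_heat_normTruncation (hf : ∀ x y, |f x - f y| ≤ L * ‖x - y‖) (x : V) (s : ℝ)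
    {ρ : ℝ} (hρ : 0 ≤ ρ) :
    Integrable (fun z => f (x + s • normTruncation ρ z)) (stdGaussian V) :=
  integrable_comp_of_abs_sub_le hf x s (measurable_normTruncation ρ)
    (integrable_norm_normTruncation hρ)

theorem abs_integral_sub_integral_normTruncation_le (hL : 0 ≤ L)
    (hf : ∀ x y, |f x - f y| ≤ L * ‖x - y‖) (x : V) {s : ℝ} (hs : |s| ≤ 1) {ρ : ℝ} (hρ : 0 < ρ) :
    |∫ z, f (x + s • z) ∂(stdGaussian V) - ∫ z, f (x + s • normTruncation ρ z) ∂(stdGaussian V)|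
      ≤ L * d / ρ := by
  rw [← integral_sub (integrable_heat hf x s) (integrable_heat_normTruncation hf x s hρ.le)]
  have h := norm_integral_le_of_norm_le (μ := stdGaussian V)
    (f := fun z => f (x + s • z) - f (x + s • normTruncation ρ z))
    (integrable_norm_sq_stdGaussian.const_mul (L / ρ)) (ae_of_all _ fun z => ?_)
  · rw [integral_const_mul, integral_norm_sq_stdGaussian, Real.norm_eq_abs] at h
    exact h.trans_eq (by ring)
  · rw [Real.norm_eq_abs]
    refine (hf _ _).trans ?_
    rw [add_sub_add_left_eq_sub, ← smul_sub, norm_smul, Real.norm_eq_abs]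
    calc L * (|s| * ‖z - normTruncation ρ z‖) ≤ L * (1 * (‖z‖ ^ 2 / ρ)) := by
          gcongr
          exact norm_sub_normTruncation_le hρ z
      _ = L / ρ * ‖z‖ ^ 2 := by ring

theorem abs_heat_shift_sub_le (hL : 0 ≤ L) (hf : ∀ x y, |f x - f y| ≤ L * ‖x - y‖) (x y : V)
    (s r : ℝ) {w : V} {ρ : ℝ} (hw : ‖w‖ ≤ ρ) :
    |f (x + s • w) - f (y + r • w)| ≤ L * (‖x - y‖ + |s - r| * ρ) := by
  refine (hf _ _).trans (mul_le_mul_of_nonneg_left ?_ hL)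
  have : x + s • w - (y + r • w) = (x - y) + (s - r) • w := by rw [sub_smul]; abel
  rw [this]
  refine (norm_add_le _ _).trans ?_
  rw [norm_smul, Real.norm_eq_abs]
  gcongr

theorem abs_integral_normTruncation_sub_le (hL : 0 ≤ L) (hf : ∀ x y, |f x - f y| ≤ L * ‖x - y‖)
    (x y : V) (s r : ℝ) {ρ : ℝ} (hρ : 0 ≤ ρ) :
    |∫ z, f (x + s • normTruncation ρ z) ∂(stdGaussian V)
      - ∫ z, f (y + r • normTruncation ρ z) ∂(stdGaussian V)| ≤ L * (‖x - y‖ + |s - r| * ρ) := by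
  rw [← integral_sub (integrable_heat_normTruncation hf x s hρ)
    (integrable_heat_normTruncation hf y r hρ)]
  have h := norm_integral_le_of_norm_le_const (μ := stdGaussian V)
    (f := fun z => f (x + s • normTruncation ρ z) - f (y + r • normTruncation ρ z))
    (ae_of_all _ fun z => abs_heat_shift_sub_le hL hf x y s r (norm_normTruncation_le hρ z))
  simpa using h

theorem le_integral_heat (hf : ∀ x y, |f x - f y| ≤ L * ‖x - y‖) {c : ℝ} (hc : ∀ x, c ≤ f x)
    (x : V) (s : ℝ) : c ≤ ∫ z, f (x + s • z) ∂(stdGaussian V) := by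
  have := integral_mono (μ := stdGaussian V) (integrable_const c) (integrable_heat hf x s)
    fun z => hc _
  simpa using this

/-- Compare `f (x + s • z)` with `f z`, whose mean is one: the displacement `x + (s - 1) • z` has
norm at most `‖x‖ + ‖z‖`. -/
theorem integral_heat_le (hL : 0 ≤ L) (hf : ∀ x y, |f x - f y| ≤ L * ‖x - y‖)
    (h1 : ∫ z, f z ∂(stdGaussian V) = 1) (x : V) {s : ℝ} (hs : s ∈ Set.Icc (0 : ℝ) 1) :
    ∫ z, f (x + s • z) ∂(stdGaussian V) ≤ 1 + L * (‖x‖ + (d + 1)) := by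
  have hfi : Integrable f (stdGaussian V) := by simpa using integrable_heat hf 0 1
  have hb : Integrable (fun z : V => L * (‖x‖ + ‖z‖)) (stdGaussian V) :=
    ((integrable_const _).add integrable_norm_stdGaussian).const_mul _
  have := integral_mono (μ := stdGaussian V) (integrable_heat hf x s) (hfi.add hb) fun z => ?_
  · refine this.trans ?_
    simp only [Pi.add_apply]
    rw [integral_add hfi hb, h1, integral_const_mul,
      integral_add (integrable_const _) integrable_norm_stdGaussian]
    simp only [integral_const, probReal_univ, smul_eq_mul, one_mul]
    gcongr
    exact integral_norm_stdGaussian_le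
  · simp only [Pi.add_apply]
    have h := (le_abs_self _).trans (hf (x + s • z) z)
    have h2 : ‖x + s • z - z‖ ≤ ‖x‖ + ‖z‖ := by
      have : x + s • z - z = x + (s - 1) • z := by rw [sub_smul, one_smul]; abel
      rw [this]
      refine (norm_add_le _ _).trans ?_
      rw [norm_smul, Real.norm_eq_abs]
      have : |s - 1| ≤ 1 := abs_le.2 ⟨by linarith [hs.1], by linarith [hs.2]⟩
      nlinarith [norm_nonneg z]
    linarith [mul_le_mul_of_nonneg_left h2 hL]

theorem integral_eq_one_of_withDensity {Ω : Type*} [MeasurableSpace Ω] {ν : Measure Ω}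
    {f : Ω → ℝ} (hf : Measurable f) (h0 : ∀ x, 0 ≤ f x)
    [h : IsProbabilityMeasure (ν.withDensity fun x => ENNReal.ofReal (f x))] :
    ∫ x, f x ∂ν = 1 := by
  rw [integral_eq_lintegral_of_nonneg_ae (ae_of_all _ h0) hf.aestronglyMeasurable]
  have := h.measure_univ
  rw [withDensity_apply _ MeasurableSet.univ, Measure.restrict_univ] at this
  rw [this, ENNReal.toReal_one]

end Lipschitz

/-! ### Derivatives of the heat semigroup and of its logarithm -/

section Gradient

variable {d : ℕ} {f : EuclideanSpace ℝ (Fin d) → ℝ} {L c : ℝ}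

local notation "V" => EuclideanSpace ℝ (Fin d)

theorem norm_gradient_sub_gradient {E : Type*} [NormedAddCommGroup E] [InnerProductSpace ℝ E]
    [CompleteSpace E] (f g : E → ℝ) (x y : E) :
    ‖∇ f x - ∇ g y‖ = ‖fderiv ℝ f x - fderiv ℝ g y‖ := by
  rw [gradient, gradient, ← map_sub, LinearIsometryEquiv.norm_map]

theorem IsRegularDensity.norm_fderiv_le (hf : IsRegularDensity f L c) (hL : 0 ≤ L) (x : V) :
    ‖fderiv ℝ f x‖ ≤ L := by
  refine norm_fderiv_le_of_lip' ℝ hL (Filter.Eventually.of_forall fun y => ?_)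
  exact hf.lipschitz y x

theorem IsRegularDensity.norm_fderiv_sub_le (hf : IsRegularDensity f L c) (x y : V) :
    ‖fderiv ℝ f x - fderiv ℝ f y‖ ≤ L * ‖x - y‖ := by
  rw [← norm_gradient_sub_gradient]
  exact hf.lipschitz_gradient x y

theorem IsRegularDensity.continuous_fderiv (hf : IsRegularDensity f L c) :
    Continuous (fderiv ℝ f) :=
  (LipschitzWith.of_dist_le_mul (K := L.toNNReal) fun x y => by
    rw [dist_eq_norm, dist_eq_norm]
    exact (hf.norm_fderiv_sub_le x y).trans (mul_le_mul_of_nonneg_right (Real.le_coe_toNNReal L)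
      (norm_nonneg _))).continuous

/-- Differentiation under the integral, dominated by the constant `L`. -/
theorem IsRegularDensity.hasFDerivAt_heat (hf : IsRegularDensity f L c) (hL : 0 ≤ L) (s : ℝ)
    (x : V) : HasFDerivAt (fun x => ∫ z, f (x + s • z) ∂(stdGaussian V))
      (∫ z, fderiv ℝ f (x + s • z) ∂(stdGaussian V)) x := by
  refine hasFDerivAt_integral_of_dominated_of_fderiv_le (bound := fun _ => L)
    (F' := fun x z => fderiv ℝ f (x + s • z)) Filter.univ_mem
    (Filter.Eventually.of_forall fun y => (integrable_heat hf.lipschitz y s).1)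
    (integrable_heat hf.lipschitz x s)
    (hf.continuous_fderiv.comp (by fun_prop)).aestronglyMeasurable
    (ae_of_all _ fun z y _ => hf.norm_fderiv_le hL _) (integrable_const _)
    (ae_of_all _ fun z y _ => ?_)
  exact (hf.differentiable _).hasFDerivAt.comp y ((hasFDerivAt_id y).add_const (s • z))

theorem IsRegularDensity.norm_integral_fderiv_le (hf : IsRegularDensity f L c) (hL : 0 ≤ L)
    (s : ℝ) (x : V) : ‖∫ z, fderiv ℝ f (x + s • z) ∂(stdGaussian V)‖ ≤ L := by
  simpa using norm_integral_le_of_norm_le_const (μ := stdGaussian V)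
    (ae_of_all _ fun z => hf.norm_fderiv_le hL (x + s • z))

theorem IsRegularDensity.norm_integral_fderiv_sub_le (hf : IsRegularDensity f L c) (hL : 0 ≤ L)
    (s : ℝ) (x y : V) : ‖∫ z, fderiv ℝ f (x + s • z) ∂(stdGaussian V)
      - ∫ z, fderiv ℝ f (y + s • z) ∂(stdGaussian V)‖ ≤ L * ‖x - y‖ := by
  have hi (x : V) : Integrable (fun z => fderiv ℝ f (x + s • z)) (stdGaussian V) :=
    (integrable_const L).mono' (hf.continuous_fderiv.comp (by fun_prop)).aestronglyMeasurable
      (ae_of_all _ fun z => hf.norm_fderiv_le hL _)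
  rw [← integral_sub (hi x) (hi y)]
  simpa using norm_integral_le_of_norm_le_const (μ := stdGaussian V)
    (f := fun z => fderiv ℝ f (x + s • z) - fderiv ℝ f (y + s • z)) (C := L * ‖x - y‖)
    (ae_of_all _ fun z => (hf.norm_fderiv_sub_le _ _).trans_eq (by simp))

end Gradient

section LogDerivative

variable {E : Type*} [NormedAddCommGroup E] [NormedSpace ℝ E] {q : E → ℝ} {q' : E → E →L[ℝ] ℝ}
  {L c : ℝ}

theorem norm_inv_smul_le (hc : 0 < c) (hq : ∀ x, c ≤ q x) (hb : ∀ x, ‖q' x‖ ≤ L) (x : E) :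
    ‖(q x)⁻¹ • q' x‖ ≤ L / c := by
  have h0 := hc.trans_le (hq x)
  rw [norm_smul, norm_inv, Real.norm_eq_abs, abs_of_pos h0, inv_mul_eq_div]
  exact div_le_div₀ ((norm_nonneg _).trans (hb x)) (hb x) hc (hq x)

/-- Vary the numerator and the denominator of `q' / q` separately; the second variation costs one
more factor `L / c`. -/
theorem norm_inv_smul_sub_le (hc : 0 < c) (hL : 0 ≤ L) (hq : ∀ x, c ≤ q x)
    (hb : ∀ x, ‖q' x‖ ≤ L) (hlip : ∀ x y, |q x - q y| ≤ L * ‖x - y‖)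
    (hlip' : ∀ x y, ‖q' x - q' y‖ ≤ L * ‖x - y‖) (x y : E) :
    ‖(q x)⁻¹ • q' x - (q y)⁻¹ • q' y‖ ≤ (L / c + (L / c) ^ 2) * ‖x - y‖ := by
  have hx := hc.trans_le (hq x)
  have hy := hc.trans_le (hq y)
  have h : (q x)⁻¹ • q' x - (q y)⁻¹ • q' y
      = (q x)⁻¹ • (q' x - q' y) + ((q x)⁻¹ * (q y - q x)) • ((q y)⁻¹ • q' y) := by
    rw [smul_sub, smul_smul, sub_add, sub_right_inj, ← sub_smul]
    congr 1
    field_simp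
    ring
  have hi : |(q x)⁻¹| ≤ c⁻¹ := by
    rw [abs_of_pos (inv_pos.2 hx)]
    exact inv_anti₀ hc (hq x)
  rw [h]
  refine (norm_add_le _ _).trans ?_
  rw [norm_smul, norm_smul, Real.norm_eq_abs, Real.norm_eq_abs, abs_mul]
  calc |(q x)⁻¹| * ‖q' x - q' y‖ + |(q x)⁻¹| * |q y - q x| * ‖(q y)⁻¹ • q' y‖
      ≤ c⁻¹ * (L * ‖x - y‖) + c⁻¹ * (L * ‖x - y‖) * (L / c) := by
        have h1 := hlip y x
        rw [norm_sub_rev] at h1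
        gcongr
        · exact hlip' x y
        · exact norm_inv_smul_le hc hq hb y
    _ = (L / c + (L / c) ^ 2) * ‖x - y‖ := by field_simp

/-- By the mean value theorem the slope is the derivative along `e` at a point within distance `h`
of `x`. -/
theorem abs_slope_sub_le {g : E → ℝ} {g' : E → E →L[ℝ] ℝ} {K : ℝ}
    (hg : ∀ x, HasFDerivAt g (g' x) x) (hK : ∀ x y, ‖g' x - g' y‖ ≤ K * ‖x - y‖) (x : E) {e : E}
    (he : ‖e‖ = 1) {h : ℝ} (hh : 0 < h) :
    |(g (x + h • e) - g x) / h - g' x e| ≤ K * h := by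
  have hd (r : ℝ) : HasDerivAt (fun r : ℝ => g (x + r • e)) (g' (x + r • e) e) r := by
    have h1 : HasDerivAt (fun r : ℝ => x + r • e) e r := by
      simpa using ((hasDerivAt_id r).smul_const e).const_add x
    exact (hg _).comp_hasDerivAt r h1
  obtain ⟨r, hr, hre⟩ := exists_hasDerivAt_eq_slope (fun r : ℝ => g (x + r • e))
    (fun r => g' (x + r • e) e) hh (fun r _ => (hd r).continuousAt.continuousWithinAt)
    fun r _ => hd r
  simp only [zero_smul, add_zero, sub_zero] at hre
  rw [← hre, ← sub_apply]
  have hK0 : 0 ≤ K := by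
    have := (norm_nonneg _).trans (hK (x + e) x)
    simpa [he] using this
  refine ((g' (x + r • e) - g' x).le_opNorm e).trans ?_
  rw [he, mul_one]
  refine (hK _ _).trans ?_
  rw [add_sub_cancel_left, norm_smul, he, mul_one, Real.norm_eq_abs, abs_of_pos hr.1]
  exact mul_le_mul_of_nonneg_left hr.2.le hK0

end LogDerivative

section LogHeat

variable {d : ℕ} {f : EuclideanSpace ℝ (Fin d) → ℝ} {L c : ℝ}

local notation "V" => EuclideanSpace ℝ (Fin d)

theorem IsRegularDensity.hasFDerivAt_log_heat (hf : IsRegularDensity f L c) (hL : 0 ≤ L) (s : ℝ)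
    (x : V) : HasFDerivAt (fun x => Real.log (∫ z, f (x + s • z) ∂(stdGaussian V)))
      ((∫ z, f (x + s • z) ∂(stdGaussian V))⁻¹ •
        ∫ z, fderiv ℝ f (x + s • z) ∂(stdGaussian V)) x :=
  (hf.hasFDerivAt_heat hL s x).log
    (hf.pos.trans_le (le_integral_heat hf.lipschitz hf.lower_bound x s)).ne'

theorem gradient_apply_eq_fderiv {g : V → ℝ} {g' : V →L[ℝ] ℝ} {x : V} (hg : HasFDerivAt g g' x)
    (i : Fin d) : (∇ g x) i = g' (EuclideanSpace.single i 1) := by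
  have : inner ℝ (∇ g x) (EuclideanSpace.single i 1) = g' (EuclideanSpace.single i 1) := by
    rw [gradient, InnerProductSpace.toDual_symm_apply, hg.fderiv]
  rw [← this, EuclideanSpace.inner_single_right]
  simp

theorem IsRegularDensity.abs_gradient_log_heat_le (hf : IsRegularDensity f L c) (hL : 0 ≤ L)
    (s : ℝ) (x : V) (i : Fin d) :
    |(∇ (fun x => Real.log (∫ z, f (x + s • z) ∂(stdGaussian V))) x) i| ≤ L / c := by
  rw [gradient_apply_eq_fderiv (hf.hasFDerivAt_log_heat hL s x)]
  rw [← Real.norm_eq_abs]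
  refine (ContinuousLinearMap.le_opNorm _ _).trans ?_
  rw [PiLp.norm_single, norm_one, mul_one]
  exact norm_inv_smul_le hf.pos
    (fun x => le_integral_heat hf.lipschitz hf.lower_bound x s)
    (fun x => hf.norm_integral_fderiv_le hL s x) x

theorem IsRegularDensity.abs_slope_log_heat_sub_le (hf : IsRegularDensity f L c) (hL : 0 ≤ L)
    (s : ℝ) (x : V) (i : Fin d) {h : ℝ} (hh : 0 < h) :
    |(Real.log (∫ z, f (x + h • EuclideanSpace.single i 1 + s • z) ∂(stdGaussian V))
        - Real.log (∫ z, f (x + s • z) ∂(stdGaussian V))) / h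
      - (∇ (fun x => Real.log (∫ z, f (x + s • z) ∂(stdGaussian V))) x) i|
      ≤ (L / c + (L / c) ^ 2) * h := by
  rw [gradient_apply_eq_fderiv (hf.hasFDerivAt_log_heat hL s x)]
  refine abs_slope_sub_le (g := fun x => Real.log (∫ z, f (x + s • z) ∂(stdGaussian V)))
    (fun x => hf.hasFDerivAt_log_heat hL s x) ?_ x (by simp) hh
  refine norm_inv_smul_sub_le hf.pos hL
    (fun x => le_integral_heat hf.lipschitz hf.lower_bound x s)
    (fun x => hf.norm_integral_fderiv_le hL s x) (fun x y => ?_)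
    (fun x y => hf.norm_integral_fderiv_sub_le hL s x y)
  rw [← integral_sub (integrable_heat hf.lipschitz x s) (integrable_heat hf.lipschitz y s)]
  simpa using norm_integral_le_of_norm_le_const (μ := stdGaussian V)
    (f := fun z => f (x + s • z) - f (y + s • z)) (C := L * ‖x - y‖)
    (ae_of_all _ fun z => (hf.lipschitz _ _).trans_eq (by simp))

end LogHeat

/-! ### Monte Carlo approximation on a grid -/

section MonteCarlo

variable {d : ℕ}

local notation "V" => EuclideanSpace ℝ (Fin d)

theorem norm_le_sum_abs (x : V) : ‖x‖ ≤ ∑ i, |x i| := by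
  rw [EuclideanSpace.norm_eq]
  refine Real.sqrt_le_iff.2 ⟨Finset.sum_nonneg fun i _ => abs_nonneg _, ?_⟩
  simpa using Finset.sum_sq_le_sq_sum_of_nonneg (s := Finset.univ) (f := fun i => |x i|)
    fun i _ => abs_nonneg _

theorem norm_le_mul_of_abs_le {x : V} {δ : ℝ} (h : ∀ i, |x i| ≤ δ) : ‖x‖ ≤ d * δ := by
  refine (norm_le_sum_abs x).trans ((Finset.sum_le_sum fun i _ => h i).trans_eq ?_)
  simp

theorem exists_fin_abs_sub_div_le {n : ℕ} (hn : 0 < n) {u : ℝ} (hu : u ∈ Set.Icc (0 : ℝ) 1) :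
    ∃ k : Fin (n + 1), |u - k / n| ≤ 1 / n := by
  have hn' : (0 : ℝ) < n := Nat.cast_pos.2 hn
  have h0 : 0 ≤ u * n := mul_nonneg hu.1 hn'.le
  refine ⟨⟨⌊u * n⌋₊, Nat.lt_succ_of_le (Nat.floor_le_of_le (by nlinarith [hu.2]))⟩, ?_⟩
  have h1 := Nat.floor_le h0
  have h2 := Nat.lt_floor_add_one (u * n)
  have : u - (⌊u * n⌋₊ : ℝ) / n = (u * n - ⌊u * n⌋₊) / n := by field_simp
  simp only
  rw [this, abs_div, abs_of_pos hn']
  gcongr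
  rw [abs_le]
  constructor <;> linarith

/-- The point of the cube `[-R, R]ᵈ` with indices `p` in the grid of mesh `2 * R / n`. -/
noncomputable def cubeGridPoint (R : ℝ) (n : ℕ) (p : Fin d → Fin (n + 1)) : V :=
  WithLp.toLp 2 fun i => R * (2 * (p i / n) - 1)

theorem exists_norm_sub_cubeGridPoint_le {R : ℝ} (hR : 0 < R) {n : ℕ} (hn : 0 < n) {x : V}
    (hx : ‖x‖ ≤ R) : ∃ p, ‖x - cubeGridPoint R n p‖ ≤ d * (2 * R / n) := by
  have hk (i : Fin d) : ∃ k : Fin (n + 1), |(x i + R) / (2 * R) - k / n| ≤ 1 / n := by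
    have := abs_le.1 ((PiLp.norm_apply_le x i).trans hx)
    refine exists_fin_abs_sub_div_le hn ⟨div_nonneg (by linarith) (by linarith), ?_⟩
    rw [div_le_one (by linarith)]
    linarith
  choose p hp using hk
  refine ⟨p, norm_le_mul_of_abs_le fun i => ?_⟩
  have : (x - cubeGridPoint R n p) i = 2 * R * ((x i + R) / (2 * R) - p i / n) := by
    simp only [cubeGridPoint, PiLp.sub_apply]
    field_simp
    ring
  rw [this, abs_mul, abs_of_pos (by linarith)]
  calc 2 * R * |(x i + R) / (2 * R) - p i / n| ≤ 2 * R * (1 / n) :=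
        mul_le_mul_of_nonneg_left (hp i) (by linarith)
    _ = 2 * R / n := by ring

variable {f : EuclideanSpace ℝ (Fin d) → ℝ} {L : ℝ}

/-- Monte Carlo approximation of the heat semigroup, uniformly over a ball and over the times
`s ^ 2` with `s ∈ [0, 1]`. -/
theorem exists_sample_heat (hL : 0 < L) (hf : ∀ x y, |f x - f y| ≤ L * ‖x - y‖)
    {R ρ η : ℝ} (hR : 0 < R) (hρ : 0 < ρ) (hη : 0 < η) {n N : ℕ} (hn : 0 < n) (hN : 0 < N)
    (h : 2 * ((n : ℝ) + 1) ^ (d + 1) * Real.exp (-(N * η ^ 2 / (2 * (L * ρ) ^ 2))) < 1) :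
    ∃ w : Fin N → V, (∀ j, ‖w j‖ ≤ ρ) ∧ ∀ x : V, ‖x‖ ≤ R → ∀ s ∈ Set.Icc (0 : ℝ) 1,
      |(N : ℝ)⁻¹ * ∑ j, f (x + s • w j) - ∫ z, f (x + s • z) ∂(stdGaussian V)|
        ≤ η + L * d / ρ + 2 * (L * (d * (2 * R / n) + 1 / n * ρ)) := by
  have hN' : (0 : ℝ) < N := Nat.cast_pos.2 hN
  let K := (Fin d → Fin (n + 1)) × Fin (n + 1)
  let X (k : K) : V := cubeGridPoint R n k.1
  let T (k : K) : ℝ := k.2 / n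
  have hT (k : K) : |T k| ≤ 1 := by
    simp only [T]
    rw [abs_of_nonneg (by positivity)]
    exact div_le_one_of_le₀ (Nat.cast_le.2 (Nat.lt_succ_iff.1 k.2.2)) (by positivity)
  have hm := measurable_normTruncation (E := V) ρ
  have hfm := (continuous_of_abs_sub_le hf).measurable
  -- Subtracting `f (X k)` makes the sampled functions bounded by `L * ρ`, whatever the size of `f`.
  obtain ⟨z, hz⟩ := exists_sample_forall_abs_sub_integral_le (stdGaussian V)
    (g := fun (k : K) z => f (X k + T k • normTruncation ρ z) - f (X k))
    (fun k => (hfm.comp (by fun_prop)).sub_const _) (mul_pos hL hρ) hη (fun k z => by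
      refine (hf _ _).trans (mul_le_mul_of_nonneg_left ?_ hL.le)
      rw [add_sub_cancel_left, norm_smul, Real.norm_eq_abs]
      calc |T k| * ‖normTruncation ρ z‖ ≤ 1 * ρ :=
            mul_le_mul (hT k) (norm_normTruncation_le hρ.le z) (norm_nonneg _) zero_le_one
        _ = ρ := one_mul ρ) hN (by
      refine lt_of_eq_of_lt ?_ h
      congr 2
      simp [K, pow_succ])
  refine ⟨fun j => normTruncation ρ (z j), fun j => norm_normTruncation_le hρ.le _,
    fun x hx s hs => ?_⟩
  -- Passing to the nearest grid pair is paid twice, for the average and for the integral; to this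
  -- add the sampling error `η` and the truncation error.
  obtain ⟨p, hp⟩ := exists_norm_sub_cubeGridPoint_le hR hn hx
  obtain ⟨l, hl⟩ := exists_fin_abs_sub_div_le hn hs
  let k : K := (p, l)
  have hdist : L * (‖x - X k‖ + |s - T k| * ρ) ≤ L * (d * (2 * R / n) + 1 / n * ρ) := by
    gcongr
  have h1 : |(N : ℝ)⁻¹ * ∑ j, f (x + s • normTruncation ρ (z j))
      - (N : ℝ)⁻¹ * ∑ j, f (X k + T k • normTruncation ρ (z j))|
      ≤ L * (d * (2 * R / n) + 1 / n * ρ) := by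
    rw [← mul_sub, ← Finset.sum_sub_distrib, abs_mul, abs_of_pos (inv_pos.2 hN'),
      inv_mul_le_iff₀ hN']
    refine (Finset.abs_sum_le_sum_abs _ _).trans ((Finset.sum_le_sum fun j _ =>
      (abs_heat_shift_sub_le hL.le hf x (X k) s (T k)
        (norm_normTruncation_le hρ.le (z j))).trans hdist).trans_eq ?_)
    simp
  have h2 : |(N : ℝ)⁻¹ * ∑ j, f (X k + T k • normTruncation ρ (z j))
      - ∫ z, f (X k + T k • normTruncation ρ z) ∂(stdGaussian V)| ≤ η := by
    have := hz k
    rw [integral_sub (integrable_heat_normTruncation hf _ _ hρ.le) (integrable_const _),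
      Finset.sum_sub_distrib, mul_sub] at this
    simp only [Finset.sum_const, Finset.card_univ, Fintype.card_fin, nsmul_eq_mul,
      integral_const, probReal_univ, one_smul, inv_mul_cancel_left₀ hN'.ne'] at this
    rwa [sub_sub_sub_cancel_right] at this
  have h3 := (abs_integral_normTruncation_sub_le hL.le hf (X k) x (T k) s hρ.le)
  rw [norm_sub_rev, abs_sub_comm (T k)] at h3
  have h4 := abs_integral_sub_integral_normTruncation_le hL.le hf x
    (s := s) (abs_le.2 ⟨by linarith [hs.1], hs.2⟩) hρ
  rw [abs_le] at *
  constructor <;> linarith [h1.1, h1.2, h2.1, h2.2, h3.1, h3.2, h4.1, h4.2]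

end MonteCarlo

/-! ### Clipping and approximation of the logarithm -/

section Clip

/-- The truncation of `u` to `[-A, A]`, as a combination of rectified linear units. -/
noncomputable def reluClip (A u : ℝ) : ℝ :=
  reluActivation u - reluActivation (u - A) - reluActivation (-u) + reluActivation (-u - A)

theorem reluClip_eq {A : ℝ} (hA : 0 ≤ A) (u : ℝ) : reluClip A u = max (-A) (min u A) := by
  unfold reluClip reluActivation
  grind

theorem abs_reluClip_le {A : ℝ} (hA : 0 ≤ A) (u : ℝ) : |reluClip A u| ≤ A := by
  rw [reluClip_eq hA, abs_le]
  grind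

theorem abs_reluClip_sub_le {A v : ℝ} (hA : 0 ≤ A) (hv : |v| ≤ A) (u : ℝ) :
    |reluClip A u - v| ≤ |u - v| := by
  rw [reluClip_eq hA]
  grind

end Clip

section LogApprox

theorem abs_log_sub_log_le {c a b : ℝ} (hc : 0 < c) (ha : c ≤ a) (hb : c ≤ b) :
    |Real.log a - Real.log b| ≤ 1 / c * |a - b| := by
  wlog h : b ≤ a generalizing a b
  · rw [abs_sub_comm, abs_sub_comm a]
    exact this hb ha (le_of_not_ge h)
  have hb' := hc.trans_le hb
  have ha' := hc.trans_le ha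
  rw [abs_of_nonneg (sub_nonneg.2 (Real.log_le_log hb' h)), abs_of_nonneg (sub_nonneg.2 h),
    ← Real.log_div ha'.ne' hb'.ne']
  calc Real.log (a / b) ≤ a / b - 1 := Real.log_le_sub_one_of_pos (by positivity)
    _ = 1 / b * (a - b) := by field_simp
    _ ≤ 1 / c * (a - b) := by gcongr

/-- The target must be globally Lipschitz and constant far out, so `log` is composed with a tent
that is the identity on `[c, M]` and equals `c` outside `[-2 * M, 2 * M]`. Only `v` has to lie in
`[c, M]`: the approximate argument `u` may leave it. -/
theorem IsUniversalActivation.exists_log_approx {σ : ℝ → ℝ} (hσ : IsUniversalActivation σ) :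
    ∃ C : ℝ, 0 < C ∧ ∀ c M δ : ℝ, 0 < c → 0 < M → 0 < δ →
      ∃ (m : ℕ) (a : ℝ) (α β γ : Fin m → ℝ), 0 < m ∧ (m : ℝ) ≤ C * (2 * M / c / δ) + 1 ∧
        ∀ u v, c ≤ v → v ≤ M →
          |(a + ∑ i, α i * σ (β i * u + γ i)) - Real.log v| ≤ δ + |u - v| / c := by
  obtain ⟨C, hC, happ⟩ := hσ.approx
  refine ⟨C, hC, fun c M δ hc hM hδ => ?_⟩
  let h (u : ℝ) : ℝ := Real.log (max c (M - |u - M|))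
  have hlip (x y : ℝ) : |h x - h y| ≤ 1 / c * |x - y| := by
    refine (abs_log_sub_log_le hc (le_max_left _ _) (le_max_left _ _)).trans
      (mul_le_mul_of_nonneg_left ?_ (by positivity))
    grind
  obtain ⟨m, a, α, β, γ, hm, hap⟩ := happ (1 / c) (2 * M) δ (by positivity) (by positivity) hδ h
    hlip ⟨Real.log c, fun x hx => by
      simp only [h]
      rw [max_eq_left]
      rw [Set.mem_Icc] at hx
      grind⟩
  have key (u v : ℝ) (hv : c ≤ v) (hvM : v ≤ M) :
      |(a + ∑ i, α i * σ (β i * u + γ i)) - Real.log v| ≤ δ + |u - v| / c := by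
    have hv' : h v = Real.log v := by
      simp only [h]
      congr 1
      grind
    have h1 := hap u
    have h2 := hlip u v
    rw [hv'] at h2
    calc _ ≤ |a + ∑ i, α i * σ (β i * u + γ i) - h u| + |h u - Real.log v| := abs_sub_le _ _ _
      _ ≤ δ + 1 / c * |u - v| := add_le_add h1 h2
      _ = δ + |u - v| / c := by ring
  -- A null term is appended because a layer of a net must be nonempty.
  refine ⟨m + 1, a, Fin.snoc α 0, Fin.snoc β 0, Fin.snoc γ 0, m.succ_pos, ?_, fun u v hv hvM => ?_⟩
  · push_cast
    have : C * (2 * M * (1 / c) / δ) = C * (2 * M / c / δ) := by ring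
    linarith
  · simpa [Fin.sum_univ_castSucc] using key u v hv hvM

end LogApprox

/-! ### Construction of the net -/

section DriftNet

variable {d : ℕ}

local notation "V" => EuclideanSpace ℝ (Fin d)

/-- A net computing the clipped finite differences of `x ↦ ∑ l, α l * σ (β l * F x s + γ l)`, where
`F x s` is the average over `j` of the values of a given net at `x + s • w j`. -/
theorem NeuralNet.exists_drift_eq_clip {σ : ℝ → ℝ} (G : NeuralNet d 1) (hG : G.ActivationsIn {σ})
    {N m : ℕ} (hN : 0 < N) (hm : 0 < m) (w : Fin N → V) (α β γ : Fin m → ℝ) (A h : ℝ) :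
    ∃ H : NeuralNet (d + 1) d, H.ActivationsIn {σ, deriv σ, reluActivation} ∧
      H.size = (d + 1) * N * G.size + (d + 1) * m + (d + 1) * 4 ∧
      ∀ (x : V) (s : ℝ) (i : Fin d), H.drift x s i = reluClip A
        ((∑ l, α l * σ (β l * ((N : ℝ)⁻¹ * ∑ j,
            G.eval (x + h • EuclideanSpace.single i 1 + s • w j).ofLp 0) + γ l)
          - ∑ l, α l * σ (β l * ((N : ℝ)⁻¹ * ∑ j, G.eval (x + s • w j).ofLp 0) + γ l)) / h) := by
  have : Nonempty (Fin N) := ⟨⟨0, hN⟩⟩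
  have : Nonempty (Fin m) := ⟨⟨0, hm⟩⟩
  let Φ : Set (ℝ → ℝ) := {σ, deriv σ, reluActivation}
  have hG' : G.stack.ActivationsIn Φ := NeuralStack.ActivationsIn.mono (by simp [Φ]) hG
  -- `none` stands for the base point of the difference quotients, `some i` for the point shifted
  -- along coordinate `i`.
  let shift (o : Option (Fin d)) : V := o.elim 0 fun i => h • EuclideanSpace.single i 1
  have r1 := NeuralRealizable.parallel (κ := Option (Fin d) × Fin N) (n' := d + 1) G.stack hG'
    (fun p i => Fin.snoc (α := fun _ => ℝ) (fun l => if i = l then 1 else 0) (w p.2 i))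
    (fun p i => shift p.1 i)
  -- The output layer of `G` and the average over the sample are linear, so they need no nodes of
  -- their own.
  have r2 := r1.next (κ := Option (Fin d) × Fin m)
    (fun p q => if p.1 = q.1.1 then β p.2 * ((N : ℝ)⁻¹ * G.out 0 q.2) else 0)
    (fun p => γ p.2) (fun _ => σ) (by simp [Φ])
  -- The four ReLU terms of `reluClip`, with the difference quotient in the weights. The nodes
  -- indexed by `none` have zero weights and are ignored by the output.
  have r3 := r2.next (κ := Option (Fin d) × Fin 4)
    (fun p q => ![1, 1, -1, -1] p.2 * (α q.2 / h) *
      ((if q.1 = p.1 then 1 else 0) - if q.1 = none then 1 else 0))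
    (fun p => ![0, -A, 0, -A] p.2) (fun _ => reluActivation) (by simp [Φ])
  obtain ⟨H, hH, hs, hev⟩ := r3.exists_net (p := d)
    (fun i p => if p.1 = some i then ![1, -1, -1, 1] p.2 else 0)
  refine ⟨H, hH, ?_, fun x s i => ?_⟩
  · rw [hs]
    simp [NeuralNet.size]
  have hin (o : Option (Fin d)) (j : Fin N) :
      (fun i => ∑ l, (Fin.snoc (α := fun _ => ℝ) (fun l => if i = l then 1 else 0) (w j i) :
          Fin (d + 1) → ℝ) l * (Fin.snoc (α := fun _ => ℝ) x.ofLp s : Fin (d + 1) → ℝ) l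
        + shift o i) = (x + shift o + s • w j).ofLp := by
    ext i
    simp [Fin.sum_univ_castSucc]
    ring
  have hF (o : Option (Fin d)) (l : Fin m) :
      (∑ q : (Option (Fin d) × Fin N) × Fin G.width,
        (if o = q.1.1 then β l * ((N : ℝ)⁻¹ * G.out 0 q.2) else 0) *
          G.stack.eval (x + shift q.1.1 + s • w q.1.2).ofLp q.2)
        = β l * ((N : ℝ)⁻¹ * ∑ j, G.eval (x + shift o + s • w j).ofLp 0) := by
    simp only [Fintype.sum_prod_type, NeuralNet.eval, Matrix.mulVec, dotProduct, ite_mul, zero_mul]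
    rw [Finset.sum_eq_single o]
    · simp [Finset.mul_sum, mul_assoc]
    · intro b _ hb
      simp [hb.symm]
    · simp
  have hlin {c : ℝ} (u v : Fin m → ℝ) : ∑ l, c * (α l / h) * -1 * u l + ∑ l, c * (α l / h) * v l
      = c * ((∑ l, α l * v l - ∑ l, α l * u l) / h) := by
    rw [← Finset.sum_sub_distrib, Finset.sum_div, Finset.mul_sum, ← Finset.sum_add_distrib]
    exact Finset.sum_congr rfl fun l _ => by ring
  have hw (c : ℝ) : (∑ q : Option (Fin d) × Fin m, c * (α q.2 / h) *
      ((if q.1 = some i then 1 else 0) - if q.1 = none then 1 else 0) *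
        σ (β q.2 * ((N : ℝ)⁻¹ * ∑ j, G.eval (x + shift q.1 + s • w j).ofLp 0) + γ q.2))
      = c * ((∑ l, α l * σ (β l * ((N : ℝ)⁻¹ * ∑ j,
            G.eval (x + h • EuclideanSpace.single i 1 + s • w j).ofLp 0) + γ l)
          - ∑ l, α l * σ (β l * ((N : ℝ)⁻¹ * ∑ j, G.eval (x + s • w j).ofLp 0) + γ l)) / h) := by
    rw [Fintype.sum_prod_type, Fintype.sum_option, Finset.sum_eq_single i]
    · simp only [shift, Option.elim_none, Option.elim_some, add_zero, reduceCtorEq, if_true,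
        if_false, sub_zero, zero_sub, mul_one]
      exact hlin _ _
    · intro b _ hb
      simp [hb]
    · simp
  change H.eval _ i = _
  rw [hev]
  simp only [hin, hF]
  rw [Fintype.sum_prod_type, Finset.sum_eq_single (some i)]
  · simp only [Fin.sum_univ_four, Matrix.cons_val, hw, if_true, one_mul, neg_mul, add_zero]
    simp only [reluClip, sub_eq_add_neg]
  · intro b _ hb
    simp [hb]
  · simp

end DriftNet

/-! ### Polynomial growth and numerical bounds -/

theorem MvPolynomial.exists_abs_eval_le {n : ℕ} (P : MvPolynomial (Fin n) ℝ) :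
    ∃ (C : ℝ) (k : ℕ), 0 ≤ C ∧ ∀ X : ℝ, 1 ≤ X → ∀ y : Fin n → ℝ, (∀ i, |y i| ≤ X) →
      |MvPolynomial.eval y P| ≤ C * X ^ k := by
  induction P using MvPolynomial.induction_on with
  | C a => exact ⟨|a|, 0, abs_nonneg a, fun X _ y _ => by simp⟩
  | add p q hp hq =>
    obtain ⟨C, k, hC, hp⟩ := hp
    obtain ⟨C', k', hC', hq⟩ := hq
    refine ⟨C + C', k + k', by positivity, fun X hX y hy => ?_⟩
    rw [map_add]
    calc _ ≤ _ := abs_add_le _ _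
      _ ≤ C * X ^ k + C' * X ^ k' := add_le_add (hp X hX y hy) (hq X hX y hy)
      _ ≤ C * X ^ (k + k') + C' * X ^ (k + k') := by
        gcongr <;> first | exact hX | omega
      _ = _ := by ring
  | mul_X p i hp =>
    obtain ⟨C, k, hC, hp⟩ := hp
    refine ⟨C, k + 1, hC, fun X hX y hy => ?_⟩
    rw [map_mul, MvPolynomial.eval_X, abs_mul, pow_succ, ← mul_assoc]
    exact mul_le_mul (hp X hX y hy) (hy i) (abs_nonneg _) (by positivity)

section Powers

/-- Since `2 ≤ X`, numerical factors are absorbed by raising the exponent; this is why the exponents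
below are generous. -/
theorem two_mul_pow_le {X : ℝ} (hX : 2 ≤ X) (k : ℕ) : 2 * X ^ k ≤ X ^ (k + 1) := by
  rw [pow_succ, mul_comm]
  gcongr

theorem pow_le_pow_exponent {X : ℝ} (hX : 2 ≤ X) {k l : ℕ} (h : k ≤ l) : X ^ k ≤ X ^ l :=
  pow_le_pow_right₀ (by linarith) h

theorem natCeil_pow_le {X : ℝ} (hX : 2 ≤ X) (k : ℕ) : (⌈X ^ k⌉₊ : ℝ) ≤ X ^ (k + 1) := by
  have h1 : 1 ≤ X ^ k := one_le_pow₀ (by linarith)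
  have := Nat.ceil_lt_add_one (zero_le_one.trans h1)
  linarith [two_mul_pow_le hX k]

/-- By `n + 1 ≤ exp n` the grid contributes at most `exp (X ^ 43)`, against a Hoeffding exponent of
at least `X ^ 129`. -/
theorem sample_size_bound {X L : ℝ} (hX : 2 ≤ X) (hL : 0 < L) (hLX : L ≤ X) {d : ℕ}
    (hd : (d : ℝ) + 1 ≤ X) :
    2 * ((⌈X ^ 40⌉₊ : ℝ) + 1) ^ (d + 1) *
      Real.exp (-((⌈X ^ 200⌉₊ : ℝ) * ((X ^ 16)⁻¹) ^ 2 / (2 * (L * X ^ 18) ^ 2))) < 1 := by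
  have hX0 : 0 < X := by linarith
  set n : ℝ := (⌈X ^ 40⌉₊ : ℝ)
  have hn0 : 0 ≤ n := Nat.cast_nonneg _
  have hn : n ≤ X ^ 41 := natCeil_pow_le hX 40
  have hN : X ^ 200 ≤ (⌈X ^ 200⌉₊ : ℝ) := Nat.le_ceil _
  have hden : 2 * (L * X ^ 18) ^ 2 ≤ X ^ 39 := by
    calc 2 * (L * X ^ 18) ^ 2 ≤ X * (X * X ^ 18) ^ 2 := by gcongr
      _ = X ^ 39 := by ring
  have hexp : X ^ 129 ≤ (⌈X ^ 200⌉₊ : ℝ) * ((X ^ 16)⁻¹) ^ 2 / (2 * (L * X ^ 18) ^ 2) := by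
    rw [le_div_iff₀ (by positivity)]
    calc X ^ 129 * (2 * (L * X ^ 18) ^ 2) ≤ X ^ 129 * X ^ 39 := by gcongr
      _ = X ^ 200 * ((X ^ 16)⁻¹) ^ 2 := by field_simp
      _ ≤ _ := by gcongr
  have h2 : (2 : ℝ) * (n + 1) ^ (d + 1) ≤ Real.exp (1 + (d + 1 : ℕ) * n) := by
    rw [Real.exp_add, Real.exp_nat_mul]
    gcongr
    · linarith [Real.add_one_le_exp (1 : ℝ)]
    · exact Real.add_one_le_exp n
  have h3 : 1 + ((d + 1 : ℕ) : ℝ) * n < X ^ 129 := by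
    push_cast
    calc 1 + ((d : ℝ) + 1) * n ≤ X ^ 42 + X * X ^ 41 := by
          gcongr
          exact one_le_pow₀ (by linarith)
      _ = 2 * X ^ 42 := by ring
      _ ≤ X ^ 43 := two_mul_pow_le hX 42
      _ < X ^ 129 := pow_lt_pow_right₀ (by linarith) (by norm_num)
  calc _ ≤ Real.exp (1 + (d + 1 : ℕ) * n) * Real.exp (-X ^ 129) := by gcongr
    _ = Real.exp (1 + (d + 1 : ℕ) * n - X ^ 129) := by rw [← Real.exp_add, sub_eq_add_neg]
    _ < 1 := by rw [Real.exp_lt_one_iff]; linarith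

theorem sampling_error_bound {X L R D : ℝ} (hX : 2 ≤ X) (hL : 0 < L) (hLX : L ≤ X)
    (hR : 0 ≤ R) (hRX : R ≤ X) (hD : 0 ≤ D) (hDX : D ≤ X) :
    (X ^ 16)⁻¹ + ((X ^ 16)⁻¹ + L * D / X ^ 18 +
      2 * (L * (D * (2 * R / (⌈X ^ 40⌉₊ : ℝ)) + 1 / (⌈X ^ 40⌉₊ : ℝ) * X ^ 18))) ≤ (X ^ 14)⁻¹ := by
  have hX0 : 0 < X := by linarith
  have hn : X ^ 40 ≤ (⌈X ^ 40⌉₊ : ℝ) := Nat.le_ceil _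
  have h1 : L * D / X ^ 18 ≤ (X ^ 16)⁻¹ := by
    calc L * D / X ^ 18 ≤ X * X / X ^ 18 := by gcongr
      _ = (X ^ 16)⁻¹ := by field_simp
  have h2 : 2 * (L * (D * (2 * R / (⌈X ^ 40⌉₊ : ℝ)) + 1 / (⌈X ^ 40⌉₊ : ℝ) * X ^ 18))
      ≤ (X ^ 16)⁻¹ := by
    calc _ ≤ X * (X * (X * (X * X / X ^ 40) + 1 / X ^ 40 * X ^ 18)) := by gcongr
      _ = (X ^ 3 + X ^ 18) / X ^ 38 := by field_simp
      _ ≤ X ^ 19 / X ^ 38 := by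
        gcongr
        have h3 : X ^ 3 ≤ X ^ 18 := pow_le_pow_exponent hX (by norm_num)
        have h4 : 2 * X ^ 18 ≤ X ^ 19 := two_mul_pow_le hX 18
        linarith
      _ = (X ^ 19)⁻¹ := by field_simp
      _ ≤ (X ^ 16)⁻¹ := inv_anti₀ (by positivity) (pow_le_pow_exponent hX (by norm_num))
  calc _ ≤ 2 * (2 * (X ^ 16)⁻¹) := by linarith
    _ ≤ X * (X * (X ^ 16)⁻¹) := by gcongr
    _ = (X ^ 14)⁻¹ := by field_simp

theorem log_error_bound {X c E : ℝ} (hX : 2 ≤ X) (hc : 0 < c) (hcX : 1 / c ≤ X)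
    (hE : E ≤ (X ^ 14)⁻¹) : (X ^ 13)⁻¹ + E / c ≤ (X ^ 12)⁻¹ := by
  have hX0 : 0 < X := by linarith
  calc _ ≤ (X ^ 13)⁻¹ + (X ^ 14)⁻¹ * (1 / c) := by
        rw [div_eq_mul_one_div _ c]
        gcongr
    _ ≤ (X ^ 13)⁻¹ + (X ^ 14)⁻¹ * X := by gcongr
    _ = 2 * (X ^ 13)⁻¹ := by field_simp; ring
    _ ≤ X * (X ^ 13)⁻¹ := by gcongr
    _ = (X ^ 12)⁻¹ := by field_simp

/-- The step `X⁻⁸` balances the two errors: with `κ = X⁻¹²` and a Lipschitz constant of order `X ^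
4`, both have order `X⁻⁴`. -/
theorem slope_error_bound {X a : ℝ} (hX : 2 ≤ X) (ha : 0 ≤ a) (haX : a ≤ X ^ 2) :
    2 * (X ^ 12)⁻¹ / (X ^ 8)⁻¹ + (a + a ^ 2) * (X ^ 8)⁻¹ ≤ (X ^ 2)⁻¹ := by
  have hX0 : 0 < X := by linarith
  have h1 : 2 * X ^ 4 ≤ X ^ 5 := two_mul_pow_le hX 4
  have h2 : 2 * X ^ 5 ≤ X ^ 6 := two_mul_pow_le hX 5
  have h3 : X ^ 2 ≤ X ^ 4 := pow_le_pow_exponent hX (by norm_num)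
  calc _ ≤ 2 * (X ^ 12)⁻¹ / (X ^ 8)⁻¹ + (X ^ 2 + (X ^ 2) ^ 2) * (X ^ 8)⁻¹ := by gcongr
    _ = (2 * X ^ 4 + (X ^ 2 + X ^ 4)) / X ^ 8 := by
      field_simp
    _ ≤ X ^ 6 / X ^ 8 := by
      gcongr
      linarith
    _ = (X ^ 2)⁻¹ := by field_simp

theorem radius_bound {X R : ℝ} (hX : 2 ≤ X) (hR : R + 1 ≤ X) : R + 1 + X ^ 18 ≤ X ^ 20 := by
  have h1 : X ≤ X ^ 18 := le_self_pow₀ (by linarith) (by norm_num)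
  have h2 : 2 * X ^ 18 ≤ X ^ 19 := two_mul_pow_le hX 18
  have h3 : X ^ 19 ≤ X ^ 20 := pow_le_pow_exponent hX (by norm_num)
  linarith

theorem value_bound {X L D : ℝ} (hX : 2 ≤ X) (hLX : L ≤ X) (hD0 : 0 ≤ D)
    (hD : D ≤ X) : 1 + L * D ≤ X ^ 3 := by
  have hX0 : 0 < X := by linarith
  calc 1 + L * D ≤ X ^ 2 + X * X := by
        gcongr
        exact one_le_pow₀ (by linarith)
    _ = 2 * X ^ 2 := by ring
    _ ≤ X ^ 3 := two_mul_pow_le hX 2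

theorem width_bound {X c C : ℝ} (hX : 2 ≤ X) (hC : 0 ≤ C) (hc : 0 < c) (hcX : 1 / c ≤ X) :
    C * (2 * X ^ 3 / c / (X ^ 13)⁻¹) + 1 ≤ C * X ^ 18 + 1 := by
  have hX0 : 0 < X := by linarith
  gcongr
  calc 2 * X ^ 3 / c / (X ^ 13)⁻¹ = 2 * X ^ 3 * (1 / c) * X ^ 13 := by field_simp
    _ ≤ X * X ^ 3 * X * X ^ 13 := by gcongr
    _ = X ^ 18 := by ring

theorem abs_parameters_le {X L : ℝ} (hX : 2 ≤ X) {d : ℕ} (hd : (d : ℝ) ≤ X) (hL : 0 ≤ L)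
    (hLX : L ≤ X) (i : Fin 4) : |(![1 / (X ^ 16)⁻¹, (d : ℝ), L, X ^ 20] : Fin 4 → ℝ) i| ≤ X ^ 20 := by
  have hX0 : 0 < X := by linarith
  have h1 : X ≤ X ^ 20 := le_self_pow₀ (by linarith) (by norm_num)
  have h2 : |1 / (X ^ 16)⁻¹| ≤ X ^ 20 := by
    rw [one_div, inv_inv, abs_of_pos (pow_pos hX0 16)]
    exact pow_le_pow_exponent hX (by norm_num)
  have h3 : |(d : ℝ)| ≤ X ^ 20 := by rw [Nat.abs_cast]; exact hd.trans h1
  have h4 : |L| ≤ X ^ 20 := by rw [abs_of_nonneg hL]; exact hLX.trans h1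
  have h5 : |X ^ 20| ≤ X ^ 20 := (abs_of_pos (pow_pos hX0 20)).le
  fin_cases i
  exacts [h2, h3, h4, h5]

end Powers

theorem network_size_bound {X C C' m : ℝ} {k : ℕ} (hX : 2 ≤ X) (hC : 0 ≤ C) (hC' : 0 ≤ C')
    {D N G : ℝ} (hD0 : 0 ≤ D) (hD : D ≤ X) (hN0 : 0 ≤ N) (hN : N ≤ X ^ 201)
    (hG : G ≤ C * (X ^ 20) ^ k) (hm : m ≤ C' * X ^ 18 + 1) :
    D * N * G + D * m + D * 4 ≤ (C + C' + 5) * X ^ (202 + 20 * k) := by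
  have hX0 : 0 < X := by linarith
  have h1 : D * N * G ≤ C * X ^ (202 + 20 * k) := by
    calc D * N * G ≤ D * N * (C * (X ^ 20) ^ k) := by gcongr
      _ ≤ X * X ^ 201 * (C * (X ^ 20) ^ k) := by gcongr
      _ = C * X ^ (202 + 20 * k) := by rw [pow_add, pow_mul]; ring
  have h2 : X ^ 19 ≤ X ^ (202 + 20 * k) := pow_le_pow_exponent hX (by omega)
  have h3 : X ≤ X ^ (202 + 20 * k) := le_self_pow₀ (by linarith) (by omega)
  have h4 : D * m ≤ C' * X ^ 19 + X := by
    calc D * m ≤ D * (C' * X ^ 18 + 1) := by gcongr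
      _ ≤ X * (C' * X ^ 18 + 1) := by gcongr
      _ = C' * X ^ 19 + X := by ring
  nlinarith [mul_le_mul_of_nonneg_left h2 hC']

/-! ### Error analysis of the net -/

section Approximation

variable {d : ℕ} {f : EuclideanSpace ℝ (Fin d) → ℝ} {L c : ℝ}

local notation "V" => EuclideanSpace ℝ (Fin d)

/-- Finite differences of approximate logarithms of a uniform approximation of the heat semigroup
approximate the coordinates of the gradient of its logarithm. -/
theorem IsRegularDensity.abs_slope_sub_gradient_log_heat_le (hf : IsRegularDensity f L c)
    (hL : 0 ≤ L) {h κ ℓ₁ ℓ₀ : ℝ} (hh : 0 < h) (s : ℝ) (x : V) (i : Fin d)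
    (h1 : |ℓ₁ - Real.log (∫ z, f (x + h • EuclideanSpace.single i 1 + s • z)
      ∂(stdGaussian V))| ≤ κ)
    (h0 : |ℓ₀ - Real.log (∫ z, f (x + s • z) ∂(stdGaussian V))| ≤ κ) :
    |(ℓ₁ - ℓ₀) / h - (∇ (fun x => Real.log (∫ z, f (x + s • z) ∂(stdGaussian V))) x) i|
      ≤ 2 * κ / h + (L / c + (L / c) ^ 2) * h := by
  have hs := hf.abs_slope_log_heat_sub_le hL s x i hh
  set q₁ := Real.log (∫ z, f (x + h • EuclideanSpace.single i 1 + s • z) ∂(stdGaussian V))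
  set q₀ := Real.log (∫ z, f (x + s • z) ∂(stdGaussian V))
  have h2 : |(ℓ₁ - ℓ₀) / h - (q₁ - q₀) / h| ≤ 2 * κ / h := by
    rw [← sub_div, abs_div, abs_of_pos hh]
    gcongr
    rw [abs_le] at *
    constructor <;> linarith
  exact (abs_sub_le _ _ _).trans (add_le_add h2 hs)

/-- If a net approximates `f` on a ball, then a net of comparable size, times the sample size,
approximates the gradient of the logarithm of the heat semigroup on a smaller ball. -/
theorem IsRegularDensity.exists_drift_approx {σ : ℝ → ℝ} (hf : IsRegularDensity f L c) (hL : 0 < L)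
    (hint : ∫ z, f z ∂(stdGaussian V) = 1) {R ρ η h δ ε M r κ : ℝ} (hR : 0 < R) (hρ : 0 < ρ)
    (hη : 0 < η) (hh : 0 < h) (hh1 : h ≤ 1) {n N m : ℕ} (hn : 0 < n) (hN : 0 < N) (hm : 0 < m)
    (hexp : 2 * ((n : ℝ) + 1) ^ (d + 1) * Real.exp (-(N * η ^ 2 / (2 * (L * ρ) ^ 2))) < 1)
    (G : NeuralNet d 1) (hG : G.ActivationsIn {σ}) (hr : R + 1 + ρ ≤ r)
    (hGf : ∀ y : V, ‖y‖ ≤ r → |f y - G.eval y.ofLp 0| ≤ δ)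
    (hM : 1 + L * (R + 1 + (d + 1)) ≤ M) {a : ℝ} {α β γ : Fin m → ℝ}
    (hlog : ∀ u v, c ≤ v → v ≤ M →
      |(a + ∑ l, α l * σ (β l * u + γ l)) - Real.log v| ≤ ε + |u - v| / c)
    (hκ : ε + (δ + (η + L * d / ρ + 2 * (L * (d * (2 * (R + 1) / n) + 1 / n * ρ)))) / c ≤ κ) :
    ∃ H : NeuralNet (d + 1) d, H.ActivationsIn {σ, deriv σ, reluActivation} ∧
      H.size = (d + 1) * N * G.size + (d + 1) * m + (d + 1) * 4 ∧
      (∀ x : V, ‖x‖ ≤ R → ∀ s ∈ Set.Icc (0 : ℝ) 1, ∀ i,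
        |(H.drift x s - ∇ (fun y => Real.log (∫ z, f (y + s • z) ∂(stdGaussian V))) x) i|
          ≤ 2 * κ / h + (L / c + (L / c) ^ 2) * h) ∧
      ∀ (x : V) (s : ℝ) (i : Fin d), |H.drift x s i| ≤ L / c := by
  have hc := hf.pos
  have hA : 0 ≤ L / c := by positivity
  have hN' : (0 : ℝ) < N := Nat.cast_pos.2 hN
  -- Radius `R + 1`, since the difference quotients reach points at distance `h ≤ 1` from `x`.
  obtain ⟨w, hw, hsample⟩ := exists_sample_heat (f := f) (R := R + 1) hL hf.lipschitz
    (by linarith) hρ hη hn hN hexp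
  obtain ⟨H, hHact, hHsize, hH⟩ := G.exists_drift_eq_clip hG hN hm w α β γ (L / c) h
  refine ⟨H, hHact, hHsize, fun x hx s hs i => ?_, fun x s i => ?_⟩
  · have hlogF (y : V) (hy : ‖y‖ ≤ R + 1) :
        |(a + ∑ l, α l * σ (β l * ((N : ℝ)⁻¹ * ∑ j, G.eval (y + s • w j).ofLp 0) + γ l))
          - Real.log (∫ z, f (y + s • z) ∂(stdGaussian V))| ≤ κ := by
      have hnet : |(N : ℝ)⁻¹ * ∑ j, G.eval (y + s • w j).ofLp 0
          - (N : ℝ)⁻¹ * ∑ j, f (y + s • w j)| ≤ δ := by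
        rw [← mul_sub, ← Finset.sum_sub_distrib, abs_mul, abs_of_pos (inv_pos.2 hN'),
          inv_mul_le_iff₀ hN']
        refine (Finset.abs_sum_le_sum_abs _ _).trans
          ((Finset.sum_le_sum fun j _ => ?_).trans_eq (b := ∑ _j : Fin N, δ) (by simp))
        rw [abs_sub_comm]
        refine hGf _ ((norm_add_le _ _).trans (le_trans (add_le_add hy ?_) hr))
        rw [norm_smul, Real.norm_eq_abs, abs_of_nonneg hs.1]
        exact (mul_le_of_le_one_left (norm_nonneg _) hs.2).trans (hw j)
      have hF := (abs_sub_le _ _ _).trans (add_le_add hnet (hsample y hy s hs))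
      refine (hlog _ _ (le_integral_heat hf.lipschitz hf.lower_bound y s) ?_).trans
        (le_trans ?_ hκ)
      · refine (integral_heat_le hL.le hf.lipschitz hint y hs).trans (le_trans ?_ hM)
        gcongr
      · gcongr
    rw [PiLp.sub_apply, hH]
    refine (abs_reluClip_sub_le hA (hf.abs_gradient_log_heat_le hL.le s x i) _).trans ?_
    have hxh : ‖x + h • EuclideanSpace.single i (1 : ℝ)‖ ≤ R + 1 := by
      refine (norm_add_le _ _).trans (add_le_add hx ?_)
      rw [norm_smul, Real.norm_eq_abs, abs_of_pos hh]
      simpa using hh1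
    have := hf.abs_slope_sub_gradient_log_heat_le hL.le hh s x i (hlogF _ hxh)
      (hlogF x (by linarith))
    -- The additive constant `a` of the logarithm cancels in the difference, so the net omits it.
    rwa [add_sub_add_left_eq_sub] at this
  · rw [hH]
    exact abs_reluClip_le hA _

end Approximation

/-! ### Choice of parameters -/

theorem theorem3 (σ : ℝ → ℝ) (hσ : IsUniversalActivation σ) (P : MvPolynomial (Fin 4) ℝ) :
    ∃ S : MvPolynomial (Fin 6) ℝ,
      ∀ (d : ℕ) (μ : Measure (EuclideanSpace ℝ (Fin d))) (_ : IsProbabilityMeasure μ)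
        (f : EuclideanSpace ℝ (Fin d) → ℝ) (L c : ℝ),
        μ = (stdGaussian (EuclideanSpace ℝ (Fin d))).withDensity (fun x => ENNReal.ofReal (f x)) →
        IsRegularDensity f L c →
        NeuralApproximable σ P L f →
        ∀ ε R : ℝ, 0 < ε → ε < 4 * L / c → 0 < R →
          ∃ N : NeuralNet (d + 1) d,
            N.ActivationsIn {σ, deriv σ, reluActivation} ∧
            (N.size : ℝ) ≤ MvPolynomial.eval ![1 / ε, (d : ℝ), L, R, c, 1 / c] S ∧
            (∀ x ∈ Metric.closedBall (0 : EuclideanSpace ℝ (Fin d)) R, ∀ t ∈ Set.Icc (0 : ℝ) 1,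
              ‖N.drift x (√t) - ∇ (fun y => Real.log (heatSemigroup t f y)) x‖ ≤ ε) ∧
            (∀ i : Fin d, ∀ x : EuclideanSpace ℝ (Fin d), ∀ t ∈ Set.Icc (0 : ℝ) 1,
              |N.drift x (√t) i| ≤ 2 * L / c) := by
  obtain ⟨Cσ, hCσ, hlog⟩ := hσ.exists_log_approx
  obtain ⟨CP, k, hCP, hP⟩ := P.exists_abs_eval_le
  refine ⟨MvPolynomial.C (CP + Cσ + 5) * (1 + ∑ i, MvPolynomial.X i) ^ (202 + 20 * k), ?_⟩
  intro d μ hμ f L c hμf hf happ ε R hε hεL hR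
  have hc := hf.pos
  -- Otherwise no `ε` satisfies `0 < ε < 4 * L / c`.
  have hL : 0 < L := by
    by_contra! h
    have : 4 * L / c ≤ 0 := div_nonpos_of_nonpos_of_nonneg (by linarith) hc.le
    linarith
  -- The polynomial `S` is a constant times a power of this `X`. As `1 / c ≥ 1`, both `2 ≤ X` and `R
  -- + 1 + (d + 1) ≤ X` hold.
  obtain ⟨X, hXdef⟩ : ∃ X : ℝ, X = 1 + (1 / ε + d + L + R + c + 1 / c) := ⟨_, rfl⟩
  have hc1 : 1 ≤ 1 / c := by rw [le_div_iff₀ hc]; linarith [hf.le_one]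
  have hε' : 0 < 1 / ε := by positivity
  have hd0 : (0 : ℝ) ≤ d := Nat.cast_nonneg d
  have hX : 2 ≤ X := by linarith
  have hX0 : 0 < X := by linarith
  have hX1 : 1 ≤ X := by linarith
  have hcX : 1 / c ≤ X := by linarith
  have hLX : L ≤ X := by linarith
  have hpow (j : ℕ) : 0 < X ^ j := pow_pos hX0 j
  have hn : 0 < ⌈X ^ 40⌉₊ := Nat.ceil_pos.2 (hpow 40)
  have hN : 0 < ⌈X ^ 200⌉₊ := Nat.ceil_pos.2 (hpow 200)
  obtain ⟨G, hGact, -, hGsize, hG⟩ :=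
    happ (X ^ 20) ((X ^ 16)⁻¹) (hpow 20) (inv_pos.2 (hpow 16))
  obtain ⟨m, a, α, β, γ, hm0, hm, hlogap⟩ :=
    hlog c (X ^ 3) ((X ^ 13)⁻¹) hc (hpow 3) (inv_pos.2 (hpow 13))
  have hint : ∫ z, f z ∂(stdGaussian (EuclideanSpace ℝ (Fin d))) = 1 := by
    rw [hμf] at hμ
    exact integral_eq_one_of_withDensity hf.differentiable.continuous.measurable
      fun x => hc.le.trans (hf.lower_bound x)
  obtain ⟨H, hHact, hHsize, happrox, hbound⟩ := hf.exists_drift_approx hL hint hR (hpow 18)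
    (inv_pos.2 (hpow 16)) (inv_pos.2 (hpow 8)) (inv_le_one_of_one_le₀ (one_le_pow₀ hX1)) hn hN hm0
    (sample_size_bound hX hL hLX (by linarith)) G hGact (radius_bound hX (by linarith))
    (fun y hy => (hG y (mem_closedBall_zero_iff.2 hy)).1)
    (value_bound hX hLX (by linarith) (by linarith)) hlogap
    (log_error_bound hX hc hcX
      (sampling_error_bound hX hL hLX (by linarith) (by linarith) hd0 (by linarith)))
  refine ⟨H, hHact, ?_, fun x hx t ht => ?_, fun i x t _ => (hbound x _ i).trans ?_⟩
  · have hsum : MvPolynomial.eval ![1 / ε, (d : ℝ), L, R, c, 1 / c]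
        (1 + ∑ i, MvPolynomial.X i : MvPolynomial (Fin 6) ℝ) = X := by
      simp [Fin.sum_univ_six, hXdef]
    rw [map_mul, map_pow, hsum, MvPolynomial.eval_C, hHsize]
    push_cast
    exact network_size_bound hX hCP hCσ.le (by linarith) (by linarith) (Nat.cast_nonneg _)
      (natCeil_pow_le hX 200)
      (hGsize.trans ((le_abs_self _).trans (hP (X ^ 20) (one_le_pow₀ hX1) _
        (abs_parameters_le hX (by linarith) hL.le hLX))))
      (hm.trans (width_bound hX hCσ.le hc hcX))
  · have hs : √t ∈ Set.Icc (0 : ℝ) 1 := ⟨Real.sqrt_nonneg t, Real.sqrt_le_one.2 ht.2⟩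
    have hLc : L / c ≤ X ^ 2 := by
      calc L / c = L * (1 / c) := by ring
        _ ≤ X * X := by gcongr
        _ = X ^ 2 := by ring
    have hcoord (i : Fin d) := (happrox x (mem_closedBall_zero_iff.1 hx) _ hs i).trans
      (slope_error_bound hX (div_nonneg hL.le hc.le) hLc)
    -- Coordinatewise accuracy `X⁻²` leaves room for the factor `d ≤ X` lost in passing to the norm.
    calc _ ≤ d * (X ^ 2)⁻¹ := norm_le_mul_of_abs_le hcoord
      _ ≤ X * (X ^ 2)⁻¹ := by
        gcongr
        linarith
      _ = 1 / X := by field_simp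
      _ ≤ 1 / (1 / ε) := by
        gcongr
        linarith
      _ = ε := one_div_one_div ε
  · gcongr
    linarith
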